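/- Let $\mathbb U=\{z\in\mathbb C:|z|<1\}$. For functions $F,G$ analytic in $\mathbb U$ write $F\prec G$ ($F$ is subordinate to $G$) if $F=G\circ w$ in $\mathbb U$ for some analytic $w$ on $\mathbb U$ with $w(0)=0$ and $|w(z)|<1$ for $z\in\mathbb U$. For $p,n\in\{1,2,3,\dots\}$ let $\mathcal A_p$ be the class of functions $f(z)=z^p+\sum_{k=n}^{\infty}a_{k+p}z^{k+p}$ that are analytic and $p$-valent in $\mathbb U$ (every value is assumed at most $p$ times, and some value exactly $p$ times, counted with multiplicity). Let $p\in\{1,2,3,\dots\}$, $\mu\in\mathbb C\setminus\{0\}$, $\alpha\ge 0$, $\beta\in\mathbb R$ with $\alpha+i\beta\ne 0$, and let $q$ be univalent (analytic and injective) in $\mathbb U$ with $$\operatorname{Re}\Big\{1+\frac{zq''(z)}{q'(z)}\Big\}>\max\Big\{0,-\operatorname{Re}\frac{p(\alpha+i\beta)}{\mu}\Big\}\qquad(z\in\mathbb U).$$ Put $h(z)=q(z)+\dfrac{\mu z q'(z)}{p(\alpha+i\beta)}$. (1) Let $n\ge 1$. If $f\in\mathcal A_p$ satisfies $$(1+\mu)\Big(\frac{z^p}{f(z)}\Big)^{\alpha+i\beta}-\mu\,\frac{zf'(z)}{pf(z)}\Big(\frac{z^p}{f(z)}\Big)^{\alpha+i\beta}\prec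 h(z),$$ then $$\Big(\frac{z^p}{f(z)}\Big)^{\alpha+i\beta}\prec q(z).$$ Here the powers are principal values, and $(z^p/f(z))^{\alpha+i\beta}$ and $zf'(z)/(pf(z))$ take the value $1$ (their limit) at $z=0$. (2) The function $q$ is the best dominant of the differential subordination $$\Phi(z)+\frac{\mu}{p(\alpha+i\beta)}\,z\Phi'(z)\prec h(z),$$ where $\Phi$ ranges over the functions analytic in $\mathbb U$; that is, every analytic solution $\Phi$ satisfies $\Phi\prec q$, and whenever $r$ is univalent in $\mathbb U$ and every analytic solution $\Phi$ satisfies $\Phi\prec r$, then $q\prec r$. -/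

import Mathlib

namespace NonBazilevic

/-- The open unit disc of the complex plane. -/
abbrev unitDisc : Set ℂ := Metric.ball (0 : ℂ) 1

/-- A univalent function: analytic and injective on the unit disc. -/
def IsUnivalent (q : ℂ → ℂ) : Prop :=
  DifferentiableOn ℂ q unitDisc ∧ Set.InjOn q unitDisc

/-- Subordination of two functions that are analytic in the unit disc: the first one is the
composition of the second one with a Schwarz function. -/
def Subordinate (f g : ℂ → ℂ) : Prop :=
  DifferentiableOn ℂ f unitDisc ∧ DifferentiableOn ℂ g unitDisc ∧
    ∃ w : ℂ → ℂ, DifferentiableOn ℂ w unitDisc ∧ w 0 = 0 ∧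
      (∀ z ∈ unitDisc, ‖w z‖ < 1) ∧ ∀ z ∈ unitDisc, f z = g (w z)

/-- A `p`-valent function: analytic in the unit disc, assuming there every value at most `p` times
and some value exactly `p` times, with multiplicities counted. -/
def IsPValent (p : ℕ) (f : ℂ → ℂ) : Prop :=
  DifferentiableOn ℂ f unitDisc ∧
    (∀ (c : ℂ) (s : Finset ℂ), (s : Set ℂ) ⊆ unitDisc →
      ∑ z ∈ s, analyticOrderAt (fun x => f x - c) z ≤ (p : ℕ∞)) ∧
    ∃ (c : ℂ) (s : Finset ℂ), (s : Set ℂ) ⊆ unitDisc ∧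
      ∑ z ∈ s, analyticOrderAt (fun x => f x - c) z = (p : ℕ∞)

/-- The class of `p`-valent functions in the unit disc of the form
`f z = z ^ p + ∑_{k ≥ n} a_{k+p} z ^ (k + p)`; the summation index is shifted by `n`. -/
def classA (p n : ℕ) : Set (ℂ → ℂ) :=
  {f | IsPValent p f ∧
    ∃ a : ℕ → ℂ, ∀ z ∈ unitDisc,
      HasSum (fun k : ℕ => a (n + k + p) * z ^ (n + k + p)) (f z - z ^ p)}

/-- The function `(z ^ p / f z) ^ γ`, with the principal value of the power; its value at the
removable singularity `z = 0` is the limit `1`. -/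
noncomputable def powQuotient (p : ℕ) (γ : ℂ) (f : ℂ → ℂ) (z : ℂ) : ℂ :=
  if z = 0 then 1 else (z ^ p / f z) ^ γ

/-- The function `z f'(z) / (p f(z))`; its value at the removable singularity `z = 0` is the
limit `1`. -/
noncomputable def logQuotient (p : ℕ) (f : ℂ → ℂ) (z : ℂ) : ℂ :=
  if z = 0 then 1 else z * deriv f z / (p * f z)

/-- The expression `(1 + μ) (z ^ p / f) ^ γ - μ (z f' / (p f)) (z ^ p / f) ^ γ`. -/
noncomputable def definingExpr (p : ℕ) (μ γ : ℂ) (f : ℂ → ℂ) (z : ℂ) : ℂ :=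
  (1 + μ) * powQuotient p γ f z - μ * logQuotient p f z * powQuotient p γ f z

/-- The first-order differential operator `Φ ↦ Φ + η z Φ'`. -/
noncomputable def diffOp (η : ℂ) (Φ : ℂ → ℂ) (z : ℂ) : ℂ :=
  Φ z + η * z * deriv Φ z

/-- The solutions of the differential subordination `Φ + η z Φ' ≺ h`: the functions `Φ`, analytic
in the unit disc, that satisfy it. -/
def solutions (η : ℂ) (h : ℂ → ℂ) : Set (ℂ → ℂ) :=
  {Φ | DifferentiableOn ℂ Φ unitDisc ∧ Subordinate (diffOp η Φ) h}

/-- A dominant of the differential subordination `Φ + η z Φ' ≺ h`: a univalent function to which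
all solutions are subordinate. -/
def IsDominant (η : ℂ) (h r : ℂ → ℂ) : Prop :=
  IsUnivalent r ∧ ∀ Φ ∈ solutions η h, Subordinate Φ r

/-- The best dominant of the differential subordination `Φ + η z Φ' ≺ h`: a dominant that is
subordinate to every dominant. -/
def IsBestDominant (η : ℂ) (h q : ℂ → ℂ) : Prop :=
  IsDominant η h q ∧ ∀ r : ℂ → ℂ, IsDominant η h r → Subordinate q r

end NonBazilevic

/-!
Put `η = μ / (p γ)` with `γ = α + i β`, so that `h = q + η z q'`. Three facts carry the proof.

* The image under `q` of every disc about `0` is convex, with outward normal `ζ q'(ζ)` at `q ζ`: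
  since `Re (1 + z q'' / q') > 0`, this normal turns strictly monotonically, once around, along each
  circle (`IsUnivalent.eq_of_normal_eq`, `IsUnivalent.re_sub_div_normal_neg`,
  `IsUnivalent.convex_image_closedBall`).

* Since `Re (1 / η + 1 + z q'' / q') > 0`, the function `h / η` has, with respect to `q`, a
  derivative with positive real part. On a convex domain the difference quotients then have positive
  real part too, and it follows that `q ζ + m η ζ q'(ζ)` with `m ≥ 1` is not a value of `h` in
  `|z| < |ζ|` (`IsUnivalent.diffOp_ne`).
  If a solution `Φ` of `Φ + η z Φ' ≺ h` were not subordinate to `q`, Jack's lemma for `q⁻¹ ∘ Φ`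
  would turn a value of `Φ + η z Φ'` into such a point
  (`IsUnivalent.mem_image_ball_of_mem_solutions`). So `q` is a dominant; being a solution itself, it
  is the best one.

* The power `Φ = (z ^ p / f) ^ γ` satisfies `Φ + η z Φ' = (1 + μ) Φ - μ (z f' / (p f)) Φ`, once it
  is known to be holomorphic. The principal power need not be, but here the right-hand side is
  assumed holomorphic: if `γ` is not an integer and `z ^ p / f` meets the branch cut, the jump of `Φ` forces
  the other factor `1 + μ - μ z f' / (p f)` to vanish there, hence identically, although it equals
  `1` at `0` (`forall_mem_slitPlane_or_exists_int`).
-/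

/-! ### Injective holomorphic functions -/

open Metric Set Filter Topology in
/-- The derivative of an injective holomorphic function does not vanish. If `q - q z`
has a zero of order `n ≥ 2` at `z`, it is up to a constant the `n`-th power of a local coordinate
there, hence takes the same value at several points near `z`. -/
theorem deriv_ne_zero_of_injOn {q : ℂ → ℂ} {U : Set ℂ} (hU : IsOpen U)
    (hq : DifferentiableOn ℂ q U) (hinj : InjOn q U) {z : ℂ} (hz : z ∈ U) : deriv q z ≠ 0 := by
  intro h0
  have hqa : AnalyticAt ℂ q z := hq.analyticAt (hU.mem_nhds hz)
  have hFa : AnalyticAt ℂ (fun w => q w - q z) z := hqa.sub analyticAt_const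
  have htop : analyticOrderAt (fun w => q w - q z) z ≠ ⊤ := by
    intro ht
    rw [analyticOrderAt_eq_top] at ht
    have h1 : ∀ᶠ w in 𝓝[≠] z, False := by
      filter_upwards [ht.filter_mono nhdsWithin_le_nhds, self_mem_nhdsWithin,
        (hU.mem_nhds hz : U ∈ 𝓝 z) |> mem_nhdsWithin_of_mem_nhds] with w h1 h2 h3
      exact h2 (hinj h3 hz (sub_eq_zero.1 h1))
    exact h1.exists.elim fun _ h => h
  obtain ⟨n, hn⟩ := ENat.ne_top_iff_exists.1 htop
  obtain ⟨g, hga, hg0, hg⟩ := hFa.analyticOrderAt_eq_natCast.1 hn.symm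
  simp only [smul_eq_mul] at hg
  have hn2 : 2 ≤ n := by
    by_contra hlt
    have hcases : n = 0 ∨ n = 1 := by omega
    rcases hcases with rfl | rfl
    · have := hg.self_of_nhds
      simp at this
      exact hg0 this.symm
    · have h1 : HasDerivAt (fun w => (w - z) ^ 1 * g w) (1 * g z + (z - z) * deriv g z) z := by
        simpa using ((hasDerivAt_id' z).sub_const z).fun_mul hga.differentiableAt.hasDerivAt
      have h2 : HasDerivAt (fun w => q w - q z) 0 z := by
        rw [← h0]; exact hqa.differentiableAt.hasDerivAt.sub_const _
      have := h2.unique (h1.congr_of_eventuallyEq hg)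
      simp at this
      exact hg0 this.symm
  have hnC : (n : ℂ) ≠ 0 := by exact_mod_cast (by omega : n ≠ 0)
  -- the local coordinate, an `n`-th root of `(q - q z) / g z`
  set ψ : ℂ → ℂ := fun w => (w - z) * Complex.exp (Complex.log (g w / g z) / n) with hψ
  have hrt : AnalyticAt ℂ (fun w => Complex.exp (Complex.log (g w / g z) / n)) z := by
    have : AnalyticAt ℂ (fun w => g w / g z) z := hga.div analyticAt_const hg0
    refine ((this.clog ?_).div analyticAt_const hnC).cexp
    simp [hg0]
  have hψa : AnalyticAt ℂ ψ z := (analyticAt_id.sub analyticAt_const).mul hrt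
  have hψd : HasStrictDerivAt ψ 1 z := by
    have h1 : HasDerivAt ψ (1 * Complex.exp (Complex.log (g z / g z) / n) + (z - z) * _) z :=
      ((hasDerivAt_id z).sub_const z).mul hrt.differentiableAt.hasDerivAt
    have h2 := hψa.hasStrictDerivAt
    rw [h1.deriv] at h2
    simpa [hg0] using h2
  have hψ0 : ψ z = 0 := by simp [hψ]
  have hmap : map ψ (𝓝 z) = 𝓝 0 := by rw [← hψ0]; exact hψd.map_nhds_eq one_ne_zero
  have hroot : ∀ᶠ w in 𝓝 z, w ∈ U ∧ q w - q z = ψ w ^ n * g z := by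
    filter_upwards [hg, hU.mem_nhds hz, hga.continuousAt.eventually_ne hg0] with w h1 h2 h3
    refine ⟨h2, ?_⟩
    rw [h1, hψ]
    simp only [mul_pow]
    rw [← Complex.exp_nat_mul, mul_div_cancel₀ _ hnC, Complex.exp_log (div_ne_zero h3 hg0)]
    field_simp
  have himg : ψ '' {w | w ∈ U ∧ q w - q z = ψ w ^ n * g z} ∈ 𝓝 (0 : ℂ) := by
    rw [← hmap]; exact image_mem_map hroot
  obtain ⟨ε, hε⟩ : ∃ ε : ℂ, IsPrimitiveRoot ε n := ⟨_, Complex.isPrimitiveRoot_exp n (by omega)⟩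
  have hrot : Tendsto (fun t : ℂ => ε * t) (𝓝 0) (𝓝 0) := by
    simpa using (by fun_prop : Continuous fun t : ℂ => ε * t).tendsto 0
  have hev : ∀ᶠ t in 𝓝[≠] (0 : ℂ), t ∈ ψ '' {w | w ∈ U ∧ q w - q z = ψ w ^ n * g z} ∧
      ε * t ∈ ψ '' {w | w ∈ U ∧ q w - q z = ψ w ^ n * g z} ∧ t ≠ 0 := by
    filter_upwards [mem_nhdsWithin_of_mem_nhds himg, mem_nhdsWithin_of_mem_nhds (hrot himg),
      self_mem_nhdsWithin] with t h1 h2 h3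
    exact ⟨h1, h2, h3⟩
  obtain ⟨t, ⟨w₁, ⟨hw₁, e₁⟩, rfl⟩, ⟨w₂, ⟨hw₂, e₂⟩, h12⟩, ht⟩ := hev.exists
  have hww : w₂ = w₁ := by
    apply hinj hw₂ hw₁
    have : q w₂ - q z = q w₁ - q z := by rw [e₁, e₂, h12, mul_pow, hε.pow_eq_one, one_mul]
    exact sub_left_injective this
  subst hww
  have : ε = 1 := mul_right_cancel₀ ht (by rw [← h12, one_mul])
  exact hε.ne_one (by omega) this

open Metric Set Filter Topology in
/-- An injective holomorphic function on an open set has a holomorphic inverse. -/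
theorem exists_holomorphic_inverse {q : ℂ → ℂ} {U : Set ℂ} (hU : IsOpen U)
    (hq : DifferentiableOn ℂ q U) (hinj : InjOn q U) :
    ∃ k : ℂ → ℂ, (∀ z ∈ U, k (q z) = z) ∧
      ∀ z ∈ U, HasDerivAt k (deriv q z)⁻¹ (q z) := by
  have hk : ∀ z ∈ U, Function.invFunOn q U (q z) = z := fun z hz => hinj.leftInvOn_invFunOn hz
  refine ⟨Function.invFunOn q U, hk, fun z hz => ?_⟩
  have h0 := deriv_ne_zero_of_injOn hU hq hinj hz
  have hqa : AnalyticAt ℂ q z := hq.analyticAt (hU.mem_nhds hz)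
  have hmap := hqa.hasStrictDerivAt.map_nhds_eq h0
  have himg : q '' U ∈ 𝓝 (q z) := by rw [← hmap]; exact image_mem_map (hU.mem_nhds hz)
  refine HasDerivAt.of_local_left_inverse (f := q) ?_ ?_ h0 ?_
  · rw [ContinuousAt, ← hmap, tendsto_map'_iff, hk z hz]
    refine tendsto_id.congr' ?_
    filter_upwards [hU.mem_nhds hz] with w hw
    exact (hk w hw).symm
  · rw [hk z hz]; exact hqa.differentiableAt.hasDerivAt
  · filter_upwards [himg] with w hw
    exact Function.invFunOn_eq hw

/-! ### Extrema of holomorphic functions on closed discs -/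

open Metric Set in
/-- If the real part of `F` is maximal at the boundary point `ζ` of a disc about `0`, its derivative
along the circle vanishes and its outward derivative is nonnegative, so that `ζ F'(ζ) ≥ 0`. -/
theorem exists_nonneg_eq_mul_deriv_of_isMaxOn_re {F : ℂ → ℂ} {F' ζ : ℂ} (hF : HasDerivAt F F' ζ)
    (hmax : ∀ z, ‖z‖ ≤ ‖ζ‖ → (F z).re ≤ (F ζ).re) : ∃ r : ℝ, 0 ≤ r ∧ ζ * F' = r := by
  have htan : (ζ * F').im = 0 := by
    have h1 : HasDerivAt (fun θ : ℂ => F (ζ * Complex.exp (θ * Complex.I)))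
        (F' * (ζ * Complex.I)) ((0 : ℝ) : ℂ) := by
      have hin : HasDerivAt (fun θ : ℂ => ζ * Complex.exp (θ * Complex.I)) (ζ * Complex.I)
          ((0 : ℝ) : ℂ) := by
        simpa using (((hasDerivAt_id ((0 : ℝ) : ℂ)).mul_const Complex.I).cexp).const_mul ζ
      refine HasDerivAt.comp _ ?_ hin
      simpa using hF
    have h2 := h1.real_of_complex
    have hloc : IsLocalMax (fun x : ℝ => (F (ζ * Complex.exp ((x : ℂ) * Complex.I))).re) 0 := by
      refine Filter.Eventually.of_forall fun x => ?_
      have := hmax (ζ * Complex.exp ((x : ℂ) * Complex.I))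
        (by rw [norm_mul, Complex.norm_exp_ofReal_mul_I, mul_one])
      simpa using this
    have h3 := hloc.hasDerivAt_eq_zero h2
    simp only [Complex.mul_re, Complex.mul_im, Complex.I_re, Complex.I_im] at h3 ⊢
    linarith
  have hrad : 0 ≤ (ζ * F').re := by
    have h1 : HasDerivAt (fun t : ℂ => F (ζ * t)) (F' * ζ) ((1 : ℝ) : ℂ) := by
      have hin : HasDerivAt (fun t : ℂ => ζ * t) ζ ((1 : ℝ) : ℂ) := by
        simpa using (hasDerivAt_id ((1 : ℝ) : ℂ)).const_mul ζ
      refine HasDerivAt.comp _ ?_ hin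
      simpa using hF
    have h2 := h1.real_of_complex
    have hloc : IsLocalMaxOn (fun x : ℝ => (F (ζ * (x : ℂ))).re) (Icc 0 1) 1 := by
      refine IsMaxOn.localize fun x hx => ?_
      have := hmax (ζ * (x : ℂ)) (by
        rw [norm_mul, Complex.norm_real, Real.norm_of_nonneg hx.1]
        exact mul_le_of_le_one_right (norm_nonneg _) hx.2)
      simpa using this
    have h3 := hloc.hasFDerivWithinAt_nonpos (y := -1) h2.hasFDerivAt.hasFDerivWithinAt (by
      have := sub_mem_posTangentConeAt_of_segment_subset (s := Icc (0 : ℝ) 1) (x := 1) (y := 0)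
        ((convex_Icc (0 : ℝ) 1).segment_subset (by simp) (by simp))
      simpa using this)
    simp at h3
    simp only [Complex.mul_re]
    linarith
  exact ⟨(ζ * F').re, hrad, Complex.ext rfl (by simpa using htan)⟩

/-- If the modulus of `F` is maximal at the boundary point `ζ` of a disc about `0`, then the
logarithmic derivative `ζ F'(ζ) / F(ζ)` is nonnegative. -/
theorem exists_nonneg_mul_deriv_eq_of_isMaxOn_norm {F : ℂ → ℂ} {F' ζ : ℂ} (hF : HasDerivAt F F' ζ)
    (h0 : F ζ ≠ 0) (hmax : ∀ z, ‖z‖ ≤ ‖ζ‖ → ‖F z‖ ≤ ‖F ζ‖) :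
    ∃ r : ℝ, 0 ≤ r ∧ ζ * F' = r * F ζ := by
  obtain ⟨r, hr, h⟩ := exists_nonneg_eq_mul_deriv_of_isMaxOn_re (hF.div_const (F ζ))
    (fun z hz => by
      rw [div_self h0, Complex.one_re]
      refine (Complex.re_le_norm _).trans ?_
      rw [norm_div]
      exact div_le_one_of_le₀ (hmax z hz) (norm_nonneg _))
  refine ⟨r, hr, ?_⟩
  rw [← h]; field_simp

/-- The derivative of `F` vanishes at an interior local maximum of its real part. -/
theorem deriv_eq_zero_of_isLocalMax_re {F : ℂ → ℂ} {F' ζ : ℂ} (hF : HasDerivAt F F' ζ)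
    (hmax : IsLocalMax (fun z => (F z).re) ζ) : F' = 0 := by
  -- differentiate along the direction of steepest ascent
  have h1 : HasDerivAt (fun t : ℂ => F (ζ + t * star F')) (F' * star F') ((0 : ℝ) : ℂ) := by
    have hin : HasDerivAt (fun t : ℂ => ζ + t * star F') (star F') ((0 : ℝ) : ℂ) := by
      simpa using ((hasDerivAt_id' ((0 : ℝ) : ℂ)).mul_const (star F')).const_add ζ
    refine HasDerivAt.comp _ ?_ hin
    simpa using hF
  have hloc : IsLocalMax (fun x : ℝ => (F (ζ + (x : ℂ) * star F')).re) 0 := by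
    have hc : Filter.Tendsto (fun x : ℝ => ζ + (x : ℂ) * star F') (nhds 0) (nhds ζ) := by
      have : Continuous fun x : ℝ => ζ + (x : ℂ) * star F' := by fun_prop
      simpa using this.tendsto 0
    filter_upwards [hc hmax] with x hx
    simpa using hx
  have h3 := hloc.hasDerivAt_eq_zero h1.real_of_complex
  have h4 : (F' * star F').re = Complex.normSq F' := by
    rw [Complex.star_def, Complex.mul_conj, Complex.ofReal_re]
  rw [h4] at h3
  exact Complex.normSq_eq_zero.1 h3

open Metric in
/-- If the real part of `F` is maximal on a closed disc at a point where the derivative does not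
vanish, that point lies on the boundary circle and `ζ F'(ζ) > 0` there. -/
theorem norm_eq_and_exists_pos_eq_mul_deriv {F : ℂ → ℂ} {F' ζ : ℂ} {ρ : ℝ} (hρ : 0 < ρ)
    (hζ : ‖ζ‖ ≤ ρ) (hF : HasDerivAt F F' ζ) (h0 : F' ≠ 0)
    (hmax : ∀ z, ‖z‖ ≤ ρ → (F z).re ≤ (F ζ).re) : ‖ζ‖ = ρ ∧ ∃ r : ℝ, 0 < r ∧ ζ * F' = r := by
  have hn : ‖ζ‖ = ρ := by
    by_contra hne
    refine h0 (deriv_eq_zero_of_isLocalMax_re hF ?_)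
    have : closedBall (0 : ℂ) ρ ∈ nhds ζ :=
      mem_nhds_iff.2 ⟨ball 0 ρ, ball_subset_closedBall, isOpen_ball,
        mem_ball_zero_iff.2 (lt_of_le_of_ne hζ hne)⟩
    filter_upwards [this] with z hz
    exact hmax z (by simpa using hz)
  refine ⟨hn, ?_⟩
  obtain ⟨r, hr, h⟩ := exists_nonneg_eq_mul_deriv_of_isMaxOn_re hF (by rw [hn]; exact hmax)
  refine ⟨r, lt_of_le_of_ne hr ?_, h⟩
  rintro rfl
  have hζ0 : ζ ≠ 0 := norm_pos_iff.1 (hn ▸ hρ)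
  exact mul_ne_zero hζ0 h0 (by simpa using h)

/-! ### Convex univalent functions -/

namespace NonBazilevic

theorem mem_unitDisc {z : ℂ} : z ∈ unitDisc ↔ ‖z‖ < 1 := mem_ball_zero_iff

theorem unitDisc_mem_nhds {z : ℂ} (hz : ‖z‖ < 1) : unitDisc ∈ nhds z :=
  Metric.isOpen_ball.mem_nhds (mem_unitDisc.2 hz)

section Univalent

variable {q : ℂ → ℂ} (hq : IsUnivalent q)

include hq

theorem IsUnivalent.hasDerivAt {z : ℂ} (hz : ‖z‖ < 1) : HasDerivAt q (deriv q z) z :=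
  (hq.1.differentiableAt (unitDisc_mem_nhds hz)).hasDerivAt

theorem IsUnivalent.deriv_ne_zero {z : ℂ} (hz : ‖z‖ < 1) : deriv q z ≠ 0 :=
  deriv_ne_zero_of_injOn Metric.isOpen_ball hq.1 hq.2 (mem_unitDisc.2 hz)

theorem IsUnivalent.hasDerivAt_deriv {z : ℂ} (hz : ‖z‖ < 1) :
    HasDerivAt (deriv q) (deriv (deriv q) z) z :=
  ((hq.1.deriv Metric.isOpen_ball).differentiableAt (unitDisc_mem_nhds hz)).hasDerivAt

/-- On the disc, `q'` has a holomorphic logarithm. -/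
theorem IsUnivalent.exists_log_deriv : ∃ (g : ℂ → ℂ) (C : ℂ), ∀ z, ‖z‖ < 1 →
    HasDerivAt g (deriv (deriv q) z / deriv q z) z ∧ deriv q z = C * Complex.exp (g z) := by
  have hd : DifferentiableOn ℂ (fun z => deriv (deriv q) z / deriv q z) unitDisc :=
    ((hq.1.deriv Metric.isOpen_ball).deriv Metric.isOpen_ball).fun_div
      (hq.1.deriv Metric.isOpen_ball) fun z hz => hq.deriv_ne_zero (mem_unitDisc.1 hz)
  obtain ⟨g, hg⟩ := hd.isExactOn_ball
  have hg' : ∀ z, ‖z‖ < 1 → HasDerivAt g (deriv (deriv q) z / deriv q z) z := fun z hz =>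
    hg z (mem_unitDisc.2 hz)
  refine ⟨g, deriv q 0 * Complex.exp (-g 0), fun z hz => ⟨hg' z hz, ?_⟩⟩
  have hconst : ∀ w, ‖w‖ < 1 → HasDerivAt (fun w => deriv q w * Complex.exp (-g w)) 0 w := by
    intro w hw
    have h := (hq.hasDerivAt_deriv hw).fun_mul (hg' w hw).fun_neg.cexp
    refine h.congr_deriv ?_
    rw [mul_neg, mul_neg, mul_comm (Complex.exp _), ← mul_assoc,
      mul_div_cancel₀ _ (hq.deriv_ne_zero hw), add_neg_cancel]
  have heq : deriv q z * Complex.exp (-g z) = deriv q 0 * Complex.exp (-g 0) :=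
    Metric.isOpen_ball.is_const_of_deriv_eq_zero (s := unitDisc)
      (convex_ball (0 : ℂ) 1).isPreconnected
      (fun w hw => (hconst w (mem_unitDisc.1 hw)).differentiableAt.differentiableWithinAt)
      (fun w hw => (hconst w (mem_unitDisc.1 hw)).deriv) (mem_unitDisc.2 hz)
      (mem_unitDisc.2 (by simp))
  rw [← heq, mul_assoc, ← Complex.exp_add]
  simp

variable (hc : ∀ z, ‖z‖ < 1 → 0 < (1 + z * deriv (deriv q) z / deriv q z).re)

include hc

/-- The argument of `z q'(z)`, which is that of the outward normal to the image of a circle about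
`0`, increases strictly, and by `2 π` in one turn; so it does not take a value twice. -/
theorem IsUnivalent.eq_of_normal_eq {ζ ζ' : ℂ} (hζ : ‖ζ‖ < 1) (hn : ‖ζ'‖ = ‖ζ‖) {s : ℝ}
    (hs : 0 < s) (h : ζ' * deriv q ζ' = s * (ζ * deriv q ζ)) : ζ' = ζ := by
  rcases eq_or_ne ζ 0 with rfl | hζ0
  · simpa using hn
  obtain ⟨g, C, hg⟩ := hq.exists_log_deriv
  set τ : ℝ := (ζ' / ζ).arg with hτ
  have hζ' : ζ' = ζ * Complex.exp (τ * Complex.I) := by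
    have h1 := Complex.norm_mul_exp_arg_mul_I (ζ' / ζ)
    rw [norm_div, hn, div_self (norm_ne_zero_iff.2 hζ0), Complex.ofReal_one, one_mul] at h1
    rw [hτ, h1]; field_simp
  have hcirc : ∀ x : ℝ, ‖ζ * Complex.exp (x * Complex.I)‖ < 1 := fun x => by
    rwa [norm_mul, Complex.norm_exp_ofReal_mul_I, mul_one]
  set A : ℝ → ℝ := fun x => x + (g (ζ * Complex.exp (x * Complex.I))).im with hA
  have hmono : StrictMono A := by
    refine strictMono_of_hasDerivAt_pos (f' := fun x : ℝ =>
      (1 + (ζ * Complex.exp (x * Complex.I)) * deriv (deriv q) (ζ * Complex.exp (x * Complex.I)) /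
        deriv q (ζ * Complex.exp (x * Complex.I))).re) (fun x => ?_) (fun x => hc _ (hcirc x))
    set z := ζ * Complex.exp (x * Complex.I) with hz
    have hin : HasDerivAt (fun t : ℂ => ζ * Complex.exp (t * Complex.I)) (z * Complex.I)
        ((x : ℝ) : ℂ) := by
      simpa [hz, mul_assoc] using
        (((hasDerivAt_id' ((x : ℝ) : ℂ)).mul_const Complex.I).cexp).const_mul ζ
    have h1 := (HasDerivAt.comp ((x : ℝ) : ℂ) (hg z (hcirc x)).1 hin).const_mul (-Complex.I)
    have h2 := (hasDerivAt_id' x).fun_add h1.real_of_complex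
    have e1 : (-Complex.I * (deriv (deriv q) z / deriv q z * (z * Complex.I))) =
        z * deriv (deriv q) z / deriv q z := by
      linear_combination -(deriv (deriv q) z / deriv q z * z) * Complex.I_mul_I
    rw [e1] at h2
    simpa [hA] using h2
  have hturn : Complex.exp ((2 * Real.pi : ℝ) * Complex.I) = 1 := by
    push_cast; exact Complex.exp_two_pi_mul_I
  have hturn' : Complex.exp ((-(2 * Real.pi) : ℝ) * Complex.I) = 1 := by
    push_cast; rw [neg_mul, Complex.exp_neg, Complex.exp_two_pi_mul_I, inv_one]
  have hup : A (2 * Real.pi) = A 0 + 2 * Real.pi := by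
    simp only [hA, hturn]; simp; ring
  have hdown : A (-(2 * Real.pi)) = A 0 - 2 * Real.pi := by
    simp only [hA, hturn']; simp; ring
  have hτ1 := Complex.neg_pi_lt_arg (ζ' / ζ)
  have hτ2 := Complex.arg_le_pi (ζ' / ζ)
  have hpi := Real.pi_pos
  have hlt : A τ < A 0 + 2 * Real.pi := hup ▸ hmono (by linarith)
  have hgt : A 0 - 2 * Real.pi < A τ := hdown ▸ hmono (by linarith)
  have hg0 := (hg ζ hζ).2
  have hq0 := hq.deriv_ne_zero hζ
  have hexp : Complex.exp (τ * Complex.I + (g ζ' - g ζ)) = s := by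
    rw [(hg ζ' (hn ▸ hζ)).2, hg0] at h
    have hC : C ≠ 0 := by rintro rfl; simp [hg0] at hq0
    rw [Complex.exp_add, Complex.exp_sub]
    have hE := Complex.exp_ne_zero (g ζ)
    rw [hζ'] at h ⊢
    have h2 : Complex.exp (τ * Complex.I) * Complex.exp (g (ζ * Complex.exp (τ * Complex.I))) =
        s * Complex.exp (g ζ) := by
      apply mul_left_cancel₀ (mul_ne_zero hζ0 hC)
      linear_combination h
    rw [← mul_div_assoc, h2, mul_div_cancel_right₀ _ hE]
  have hlog : τ * Complex.I + (g ζ' - g ζ) = (Real.log s : ℝ) +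
      ((A τ - A 0 : ℝ) : ℂ) * Complex.I := by
    have hre : (τ * Complex.I + (g ζ' - g ζ)).re = Real.log s := by
      have := congrArg norm hexp
      rw [Complex.norm_exp, Complex.norm_real, Real.norm_of_nonneg hs.le] at this
      rw [← this, Real.log_exp]
    apply Complex.ext
    · rw [hre]; simp
    · simp [hA, ← hζ']; ring
  rw [hlog, Complex.exp_add, ← Complex.ofReal_exp, Real.exp_log hs] at hexp
  have h1 : Complex.exp (((A τ - A 0 : ℝ) : ℂ) * Complex.I) = 1 :=
    mul_left_cancel₀ (Complex.ofReal_ne_zero.2 hs.ne') (by rw [hexp, mul_one])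
  obtain ⟨k, hk⟩ := Complex.exp_eq_one_iff.1 h1
  have hk' : A τ - A 0 = k * (2 * Real.pi) := by
    have := congrArg Complex.im hk
    simpa using this
  have hk0 : k = 0 := by
    have h2 : (k : ℝ) < 1 := by
      by_contra hcon; nlinarith [not_lt.1 hcon]
    have h3 : (-1 : ℝ) < k := by
      by_contra hcon; nlinarith [not_lt.1 hcon]
    have h4 : k < 1 := by exact_mod_cast h2
    have h5 : -1 < k := by exact_mod_cast h3
    omega
  have hτ0 : τ = 0 := hmono.injective (by
    rw [hk0] at hk'; simp at hk'; linarith)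
  rw [hζ', hτ0]; simp

open Metric in
/-- The image of a closed disc lies strictly on the inner side of its tangent at `q ζ`, whose
outward normal is `ζ q'(ζ)`: a point where `Re (q / (ζ q'(ζ)))` is maximal has the same outward
normal as `q ζ`. -/
theorem IsUnivalent.re_sub_div_normal_neg {ζ z : ℂ} (hζ : ‖ζ‖ < 1) (hz : ‖z‖ ≤ ‖ζ‖)
    (hne : z ≠ ζ) : ((q z - q ζ) / (ζ * deriv q ζ)).re < 0 := by
  have hζ0 : ζ ≠ 0 := by
    rintro rfl
    exact hne (norm_le_zero_iff.1 (by simpa using hz))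
  have hN : ζ * deriv q ζ ≠ 0 := mul_ne_zero hζ0 (hq.deriv_ne_zero hζ)
  have hcont : ContinuousOn (fun z => (q z / (ζ * deriv q ζ)).re) (closedBall 0 ‖ζ‖) := by
    refine Complex.continuous_re.comp_continuousOn (ContinuousOn.div_const ?_ _)
    exact hq.1.continuousOn.mono (closedBall_subset_ball hζ)
  obtain ⟨ζ₁, hζ₁, hmax⟩ := (isCompact_closedBall (0 : ℂ) ‖ζ‖).exists_isMaxOn
    ⟨0, by simp⟩ hcont
  have huniq : ∀ ζ₂, ‖ζ₂‖ ≤ ‖ζ‖ →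
      (∀ w, ‖w‖ ≤ ‖ζ‖ → (q w / (ζ * deriv q ζ)).re ≤ (q ζ₂ / (ζ * deriv q ζ)).re) → ζ₂ = ζ := by
    intro ζ₂ h1 h2
    have h3 : ‖ζ₂‖ < 1 := h1.trans_lt hζ
    obtain ⟨hn, r, hr, h⟩ := norm_eq_and_exists_pos_eq_mul_deriv (norm_pos_iff.2 hζ0) h1
      ((hq.hasDerivAt h3).div_const (ζ * deriv q ζ))
      (div_ne_zero (hq.deriv_ne_zero h3) hN) h2
    refine hq.eq_of_normal_eq hc hζ hn hr ?_
    rw [← h, ← mul_div_assoc, div_mul_cancel₀ _ hN]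
  have hmax' : ∀ w, ‖w‖ ≤ ‖ζ‖ → (q w / (ζ * deriv q ζ)).re ≤ (q ζ₁ / (ζ * deriv q ζ)).re :=
    fun w hw => hmax (by simpa using hw)
  have h1 : ζ₁ = ζ := huniq ζ₁ (by simpa using hζ₁) hmax'
  rw [h1] at hmax'
  rw [sub_div, Complex.sub_re, sub_neg]
  refine lt_of_le_of_ne (hmax' z hz) fun heq => hne (huniq z hz fun w hw => ?_)
  rw [heq]; exact hmax' w hw

open Metric in
/-- The image of a closed disc about `0` is convex: at the point of the image nearest to a given
point outside of it, the tangent separates the two. -/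
theorem IsUnivalent.convex_image_closedBall {ρ : ℝ} (hρ : 0 < ρ) (hρ1 : ρ < 1) :
    Convex ℝ (q '' closedBall 0 ρ) := by
  rintro _ ⟨a, ha, rfl⟩ _ ⟨b, hb, rfl⟩ s t hs ht hst
  by_contra hnot
  set c : ℂ := s • q a + t • q b with hcdef
  have hne : ∀ z, ‖z‖ ≤ ρ → q z - c ≠ 0 := fun z hz h0 =>
    hnot ⟨z, by simpa using hz, sub_eq_zero.1 h0⟩
  have hcont : ContinuousOn (fun z => ‖(q z - c)⁻¹‖) (closedBall 0 ρ) :=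
    (((hq.1.continuousOn.mono (closedBall_subset_ball hρ1)).sub continuousOn_const).inv₀
      fun z hz => hne z (by simpa using hz)).norm
  obtain ⟨ζ, hζ, hmax⟩ := (isCompact_closedBall (0 : ℂ) ρ).exists_isMaxOn ⟨0, by simp [hρ.le]⟩ hcont
  have hζ' : ‖ζ‖ ≤ ρ := by simpa using hζ
  have hζ1 : ‖ζ‖ < 1 := hζ'.trans_lt hρ1
  have hc0 := hne ζ hζ'
  have hF : HasDerivAt (fun z => (q z - c)⁻¹ / (q ζ - c)⁻¹)
      (-deriv q ζ / (q ζ - c) ^ 2 / (q ζ - c)⁻¹) ζ :=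
    (((hq.hasDerivAt hζ1).sub_const c).fun_inv hc0).div_const _
  obtain ⟨hn, r, hr, h⟩ := norm_eq_and_exists_pos_eq_mul_deriv hρ hζ' hF
    (div_ne_zero (div_ne_zero (neg_ne_zero.2 (hq.deriv_ne_zero hζ1)) (pow_ne_zero 2 hc0))
      (inv_ne_zero hc0)) (fun z hz => by
      rw [div_self (inv_ne_zero hc0), Complex.one_re]
      refine (Complex.re_le_norm _).trans ?_
      rw [norm_div]
      exact div_le_one_of_le₀ (hmax (by simpa using hz)) (norm_nonneg _))
  -- `c - q ζ` is a positive multiple of the outward normal at `q ζ`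
  have hnormal : ζ * deriv q ζ = r * (c - q ζ) := by
    rw [← h]; field_simp; ring
  have hcq : c - q ζ ≠ 0 := by rw [← neg_sub]; exact neg_ne_zero.2 hc0
  have hle : ∀ z, ‖z‖ ≤ ρ → ((q z - q ζ) / (ζ * deriv q ζ)).re ≤ 0 := by
    intro z hz
    rcases eq_or_ne z ζ with rfl | hne
    · simp
    · exact (hq.re_sub_div_normal_neg hc hζ1 (hn ▸ hz) hne).le
  have h1 : (c - q ζ) / (ζ * deriv q ζ) = ((r⁻¹ : ℝ) : ℂ) := by
    have : (r : ℂ) ≠ 0 := Complex.ofReal_ne_zero.2 hr.ne'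
    rw [hnormal]; push_cast; field_simp
  have h2 : (c - q ζ) / (ζ * deriv q ζ) =
      s * ((q a - q ζ) / (ζ * deriv q ζ)) + t * ((q b - q ζ) / (ζ * deriv q ζ)) := by
    have : (s : ℂ) + t = 1 := by exact_mod_cast hst
    rw [hcdef, Complex.real_smul, Complex.real_smul]
    linear_combination (q ζ / (ζ * deriv q ζ)) * this
  have h3 := congrArg Complex.re (h1.symm.trans h2)
  rw [Complex.add_re, Complex.re_ofReal_mul, Complex.re_ofReal_mul, Complex.ofReal_re] at h3
  have ha' := hle a (by simpa using ha)
  have hb' := hle b (by simpa using hb)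
  have := inv_pos.2 hr
  nlinarith [mul_nonneg hs (neg_nonneg.2 ha'), mul_nonneg ht (neg_nonneg.2 hb')]

end Univalent

end NonBazilevic

/-! ### The best dominant -/

namespace NonBazilevic

theorem IsUnivalent.hasDerivAt_diffOp {q : ℂ → ℂ} (hq : IsUnivalent q) (η : ℂ) {z : ℂ}
    (hz : ‖z‖ < 1) :
    HasDerivAt (diffOp η q) (deriv q z + η * (deriv q z + z * deriv (deriv q) z)) z := by
  have h := (hq.hasDerivAt hz).fun_add
    (((hasDerivAt_id' z).const_mul η).fun_mul (hq.hasDerivAt_deriv hz))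
  exact h.congr_deriv (by ring)

open Metric in
/-- The points `q ζ + (1 + t) η ζ q'(ζ)` with `t ≥ 0` avoid the values of `q + η z q'` in the disc
`|z| < |ζ|`. Written as a function of `q`, the function `(q + η z q') / η` has a derivative with
positive real part on a convex domain, so its difference quotients lie in the right half-plane. So
do the quotients of `q ζ - q ω` by the outward normal `ζ q'(ζ)`, and a product of two numbers in the
right half-plane is not `≤ 0`. -/
theorem IsUnivalent.diffOp_ne {q : ℂ → ℂ} (hq : IsUnivalent q) {η : ℂ} (hη : η ≠ 0)
    (hc : ∀ z, ‖z‖ < 1 → 0 < (1 + z * deriv (deriv q) z / deriv q z).re)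
    (hcη : ∀ z, ‖z‖ < 1 → 0 < (1 / η + (1 + z * deriv (deriv q) z / deriv q z)).re)
    {ζ ω : ℂ} (hζ : ‖ζ‖ < 1) (hω : ‖ω‖ < ‖ζ‖) {t : ℝ} (ht : 0 ≤ t) :
    diffOp η q ω ≠ diffOp η q ζ + t * (η * (ζ * deriv q ζ)) := by
  intro heq
  have hω1 := hω.trans hζ
  have hζpos : 0 < ‖ζ‖ := (norm_nonneg _).trans_lt hω
  have hζ0 : ζ ≠ 0 := norm_pos_iff.1 hζpos
  have hne : ω ≠ ζ := by rintro rfl; exact lt_irrefl _ hω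
  have hN : ζ * deriv q ζ ≠ 0 := mul_ne_zero hζ0 (hq.deriv_ne_zero hζ)
  have hab : q ζ - q ω ≠ 0 :=
    sub_ne_zero.2 fun h => hne (hq.2 (mem_unitDisc.2 hζ) (mem_unitDisc.2 hω1) h).symm
  obtain ⟨k, hk, hkd⟩ := exists_holomorphic_inverse isOpen_ball hq.1 hq.2
  -- the difference quotient of `(q + η z q') / η` with respect to `q`
  have hX : 0 < ((diffOp η q ζ - diffOp η q ω) / (η * (q ζ - q ω))).re := by
    set G : ℝ → ℝ := fun s =>
      (diffOp η q (k (q ω + (s : ℂ) * (q ζ - q ω))) / (η * (q ζ - q ω))).re with hG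
    have hder : ∀ s ∈ Set.Icc (0 : ℝ) 1, ∃ d, 0 < d ∧ HasDerivAt G d s := by
      intro s hs
      obtain ⟨z, hz, hzs⟩ : q ω + (s : ℂ) * (q ζ - q ω) ∈ q '' closedBall 0 ‖ζ‖ := by
        have := hq.convex_image_closedBall hc hζpos hζ (Set.mem_image_of_mem q
          (show ω ∈ closedBall 0 ‖ζ‖ by simpa using hω.le)) (Set.mem_image_of_mem q
          (show ζ ∈ closedBall 0 ‖ζ‖ by simp)) (sub_nonneg.2 hs.2) hs.1 (by ring)
        convert this using 1
        simp only [Complex.real_smul]; push_cast; ring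
      have hz1 : ‖z‖ < 1 := lt_of_le_of_lt (by simpa using hz) hζ
      have hk' := hkd z (mem_unitDisc.2 hz1)
      have hq' := hq.deriv_ne_zero hz1
      have hin : HasDerivAt (fun s : ℂ => q ω + s * (q ζ - q ω)) (q ζ - q ω) (s : ℂ) := by
        simpa using ((hasDerivAt_id' (s : ℂ)).mul_const (q ζ - q ω)).const_add (q ω)
      rw [hzs] at hk'
      have h1 := HasDerivAt.comp (s : ℂ) hk' hin
      have hkz : k (q ω + (s : ℂ) * (q ζ - q ω)) = z := by
        rw [← hzs, hk z (mem_unitDisc.2 hz1)]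
      have h2 : HasDerivAt (diffOp η q) (deriv q z + η * (deriv q z + z * deriv (deriv q) z))
          ((k ∘ fun s : ℂ => q ω + s * (q ζ - q ω)) (s : ℂ)) := by
        rw [Function.comp_apply, hkz]; exact hq.hasDerivAt_diffOp η hz1
      have h3 := ((HasDerivAt.comp (s : ℂ) h2 h1).div_const (η * (q ζ - q ω))).real_of_complex
      refine ⟨_, ?_, h3⟩
      convert hcη z hz1 using 2
      field_simp
    have hmono : StrictMonoOn G (Set.Icc 0 1) := by
      refine strictMonoOn_of_deriv_pos (convex_Icc 0 1) (fun s hs => ?_) (fun s hs => ?_)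
      · obtain ⟨d, -, h⟩ := hder s hs
        exact h.continuousAt.continuousWithinAt
      · obtain ⟨d, hd, h⟩ := hder s (interior_subset hs)
        rwa [h.deriv]
    have h01 := hmono (Set.left_mem_Icc.2 zero_le_one) (Set.right_mem_Icc.2 zero_le_one) one_pos
    have hkω : k (q ω) = ω := hk ω (mem_unitDisc.2 hω1)
    have hkζ : k (q ζ) = ζ := hk ζ (mem_unitDisc.2 hζ)
    simp only [hG, Complex.ofReal_zero, Complex.ofReal_one, zero_mul, one_mul, add_zero,
      add_sub_cancel, hkω, hkζ] at h01
    rw [sub_div, Complex.sub_re]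
    linarith
  have hY : 0 < ((q ζ - q ω) / (ζ * deriv q ζ)).re := by
    have := hq.re_sub_div_normal_neg hc hζ hω.le hne
    rw [← neg_sub, neg_div, Complex.neg_re] at this
    linarith
  set Y := (q ζ - q ω) / (ζ * deriv q ζ) with hYdef
  have hXY : (diffOp η q ζ - diffOp η q ω) / (η * (q ζ - q ω)) = ((-t : ℝ) : ℂ) * Y⁻¹ := by
    rw [heq, hYdef]; push_cast; field_simp; ring
  rw [hXY, Complex.re_ofReal_mul, Complex.inv_re] at hX
  have := div_nonneg hY.le (Complex.normSq_nonneg Y)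
  nlinarith

open Metric in
/-- **Jack's lemma**: if a holomorphic function vanishing at `0` maps a disc into a disc and a
boundary point `z₀` to a boundary point, then `z₀ w'(z₀) = m w(z₀)` with `m ≥ 1`. By the Schwarz
lemma, `w z / z` has maximal modulus at `z₀`. -/
theorem jack_lemma {w : ℂ → ℂ} {z₀ : ℂ} (hw : ∀ z, ‖z‖ ≤ ‖z₀‖ → DifferentiableAt ℂ w z)
    (h0 : w 0 = 0) (hw0 : w z₀ ≠ 0) (hmax : ∀ z, ‖z‖ ≤ ‖z₀‖ → ‖w z‖ ≤ ‖w z₀‖) :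
    ∃ t : ℝ, 0 ≤ t ∧ z₀ * deriv w z₀ = (1 + t) * w z₀ := by
  have hz0 : z₀ ≠ 0 := by rintro rfl; exact hw0 h0
  have hdiff : DifferentiableOn ℂ w (ball 0 ‖z₀‖) := fun z hz =>
    (hw z (by simpa using (mem_ball_zero_iff.1 hz).le)).differentiableWithinAt
  have hslope : ∀ z, z ≠ 0 → dslope w 0 z = w z / z := fun z hz => by
    rw [dslope_of_ne _ hz, slope_def_field, h0, sub_zero, sub_zero]
  have hd : HasDerivAt (dslope w 0) ((deriv w z₀ * z₀ - w z₀ * 1) / z₀ ^ 2) z₀ := by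
    refine (((hw z₀ le_rfl).hasDerivAt.fun_div (hasDerivAt_id' z₀) hz0)).congr_of_eventuallyEq ?_
    filter_upwards [isOpen_ne.mem_nhds hz0] with z hz using hslope z hz
  obtain ⟨t, ht, h⟩ := exists_nonneg_mul_deriv_eq_of_isMaxOn_norm hd
    (by rw [hslope _ hz0]; exact div_ne_zero hw0 hz0) (fun z hz => by
      rw [hslope _ hz0, norm_div]
      rcases hz.lt_or_eq with hlt | heq
      · refine Complex.norm_dslope_le_div_of_mapsTo_ball hdiff (fun y hy => ?_)
          (mem_ball_zero_iff.2 hlt)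
        rw [h0]
        exact mem_closedBall_zero_iff.2 (hmax y (mem_ball_zero_iff.1 hy).le)
      · have hz' : z ≠ 0 := norm_pos_iff.1 (heq ▸ norm_pos_iff.2 hz0)
        rw [hslope _ hz', norm_div, heq]
        exact div_le_div_of_nonneg_right (hmax z hz) (norm_nonneg _))
  refine ⟨t, ht, ?_⟩
  rw [hslope _ hz0] at h
  field_simp at h
  linear_combination h

open Metric in
/-- Every solution of the differential subordination `Φ + η z Φ' ≺ q + η z q'` takes the disc of
radius `ρ` into its image under `q`. Otherwise, at a point `z₀` of smallest modulus at which this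
fails, Jack's lemma for `q⁻¹ ∘ Φ` makes `Φ z₀ + η z₀ Φ'(z₀)` one of the points that
`q + η z q'` avoids. -/
theorem IsUnivalent.mem_image_ball_of_mem_solutions {q : ℂ → ℂ} (hq : IsUnivalent q) {η : ℂ}
    (hη : η ≠ 0) (hc : ∀ z, ‖z‖ < 1 → 0 < (1 + z * deriv (deriv q) z / deriv q z).re)
    (hcη : ∀ z, ‖z‖ < 1 → 0 < (1 / η + (1 + z * deriv (deriv q) z / deriv q z)).re)
    {Φ : ℂ → ℂ} (hΦ : Φ ∈ solutions η (diffOp η q)) {ρ : ℝ} (hρ1 : ρ < 1) {z₁ : ℂ}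
    (hz₁ : ‖z₁‖ < ρ) : Φ z₁ ∈ q '' ball 0 ρ := by
  by_contra hnot
  obtain ⟨hΦd, -, -, ω, hωd, hω0, hω1, hω⟩ := hΦ
  have hΦat : ∀ z, ‖z‖ < 1 → HasDerivAt Φ (deriv Φ z) z := fun z hz =>
    (hΦd.differentiableAt (unitDisc_mem_nhds hz)).hasDerivAt
  have hρ : 0 < ρ := (norm_nonneg _).trans_lt hz₁
  have hsub : ball (0 : ℂ) ρ ⊆ unitDisc := ball_subset_ball hρ1.le
  obtain ⟨k, hk, hkd⟩ := exists_holomorphic_inverse isOpen_ball hq.1 hq.2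
  have hopen : IsOpen (q '' ball 0 ρ) := isOpen_iff_mem_nhds.2 fun y hy => by
    obtain ⟨z, hz, rfl⟩ := hy
    have ha := hq.1.analyticAt (isOpen_ball.mem_nhds (hsub hz))
    rw [← ha.hasStrictDerivAt.map_nhds_eq (hq.deriv_ne_zero (mem_unitDisc.1 (hsub hz)))]
    exact Filter.image_mem_map (isOpen_ball.mem_nhds hz)
  have hcont : ContinuousOn Φ (closedBall 0 ‖z₁‖) :=
    hΦd.continuousOn.mono (closedBall_subset_ball (hz₁.trans hρ1))
  have hcompact : IsCompact (closedBall (0 : ℂ) ‖z₁‖ ∩ Φ ⁻¹' (q '' ball 0 ρ)ᶜ) :=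
    (isCompact_closedBall _ _).of_isClosed_subset
      (hcont.preimage_isClosed_of_isClosed isClosed_closedBall hopen.isClosed_compl)
      Set.inter_subset_left
  obtain ⟨z₀, ⟨hz₀, hz₀'⟩, hmin⟩ := hcompact.exists_isMinOn ⟨z₁, by simp, hnot⟩
    continuous_norm.continuousOn
  have hz₀1 : ‖z₀‖ ≤ ‖z₁‖ := by simpa using hz₀
  have hz₀lt : ‖z₀‖ < 1 := hz₀1.trans_lt (hz₁.trans hρ1)
  have hin : ∀ z, ‖z‖ < ‖z₀‖ → Φ z ∈ q '' ball 0 ρ := fun z hz => by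
    by_contra hcon
    exact absurd (hmin (show z ∈ _ from ⟨by simpa using hz.le.trans hz₀1, hcon⟩)) (not_le.2 hz)
  have hΦ0 : Φ 0 = q 0 := by
    have := hω 0 (mem_unitDisc.2 (by simp))
    simpa [diffOp, hω0] using this
  have hz₀0 : z₀ ≠ 0 := by
    rintro rfl
    exact hz₀' ⟨0, by simpa using hρ, hΦ0.symm⟩
  have hz₀pos : 0 < ‖z₀‖ := norm_pos_iff.2 hz₀0
  have hclosed : ∀ z, ‖z‖ ≤ ‖z₀‖ → Φ z ∈ q '' closedBall 0 ρ := by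
    have hK : IsClosed (q '' closedBall 0 ρ) :=
      ((isCompact_closedBall _ _).image_of_continuousOn
        (hq.1.continuousOn.mono (closedBall_subset_ball hρ1))).isClosed
    have hcl : IsClosed (closedBall (0 : ℂ) ‖z₀‖ ∩ Φ ⁻¹' (q '' closedBall 0 ρ)) :=
      (hΦd.continuousOn.mono (closedBall_subset_ball hz₀lt)).preimage_isClosed_of_isClosed
        isClosed_closedBall hK
    have hss : closure (ball (0 : ℂ) ‖z₀‖) ⊆
        closedBall (0 : ℂ) ‖z₀‖ ∩ Φ ⁻¹' (q '' closedBall 0 ρ) :=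
      hcl.closure_subset_iff.2 fun z hz => ⟨ball_subset_closedBall hz,
        Set.image_mono ball_subset_closedBall (hin z (mem_ball_zero_iff.1 hz))⟩
    rw [closure_ball _ hz₀pos.ne'] at hss
    exact fun z hz => (hss (by simpa using hz)).2
  set w : ℂ → ℂ := fun z => k (Φ z) with hw
  have hwq : ∀ z, ‖z‖ ≤ ‖z₀‖ → ‖w z‖ ≤ ρ ∧ q (w z) = Φ z := by
    intro z hz
    obtain ⟨y, hy, hyz⟩ := hclosed z hz
    have hy' : ‖y‖ ≤ ρ := by simpa using hy
    have : w z = y := by rw [hw]; simp only; rw [← hyz, hk y (mem_unitDisc.2 (hy'.trans_lt hρ1))]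
    rw [this]; exact ⟨hy', hyz⟩
  have hwd : ∀ z, ‖z‖ ≤ ‖z₀‖ → HasDerivAt w ((deriv q (w z))⁻¹ * deriv Φ z) z := by
    intro z hz
    obtain ⟨h1, h2⟩ := hwq z hz
    have h3 := hkd (w z) (mem_unitDisc.2 (h1.trans_lt hρ1))
    rw [h2] at h3
    exact HasDerivAt.comp z h3 (hΦat z (hz.trans_lt hz₀lt))
  obtain ⟨hw₀le, hw₀q⟩ := hwq z₀ le_rfl
  have hw₀ : ‖w z₀‖ = ρ := by
    refine le_antisymm hw₀le (not_lt.1 fun hlt => hz₀' ⟨w z₀, by simpa using hlt, hw₀q⟩)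
  have hw₀1 : ‖w z₀‖ < 1 := hw₀ ▸ hρ1
  obtain ⟨t, ht, hjack⟩ := jack_lemma (fun z hz => (hwd z hz).differentiableAt)
    (by rw [hw]; simp only; rw [hΦ0, hk 0 (mem_unitDisc.2 (by simp))])
    (norm_pos_iff.1 (hw₀ ▸ hρ)) (fun z hz => hw₀ ▸ (hwq z hz).1)
  rw [(hwd z₀ le_rfl).deriv] at hjack
  have hωle : ‖ω z₀‖ ≤ ‖z₀‖ :=
    Complex.norm_le_norm_of_mapsTo_ball hωd
      (fun z hz => mem_closedBall_zero_iff.2 (hω1 z hz).le) hω0 hz₀lt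
  refine hq.diffOp_ne hη hc hcη hw₀1 (ω := ω z₀) ?_ ht ?_
  · rw [hw₀]; exact hωle.trans_lt (hz₀1.trans_lt hz₁)
  · rw [← hω z₀ (mem_unitDisc.2 hz₀lt)]
    have hq0 := hq.deriv_ne_zero hw₀1
    have h1 : z₀ * deriv Φ z₀ = (1 + t) * (w z₀ * deriv q (w z₀)) := by
      have : z₀ * deriv Φ z₀ = deriv q (w z₀) * (z₀ * ((deriv q (w z₀))⁻¹ * deriv Φ z₀)) := by
        field_simp
      rw [this, hjack]; ring
    simp only [diffOp]
    rw [hw₀q]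
    linear_combination η * h1

theorem IsUnivalent.subordinate_of_mem_solutions {q : ℂ → ℂ} (hq : IsUnivalent q) {η : ℂ}
    (hη : η ≠ 0) (hc : ∀ z, ‖z‖ < 1 → 0 < (1 + z * deriv (deriv q) z / deriv q z).re)
    (hcη : ∀ z, ‖z‖ < 1 → 0 < (1 / η + (1 + z * deriv (deriv q) z / deriv q z)).re)
    {Φ : ℂ → ℂ} (hΦ : Φ ∈ solutions η (diffOp η q)) : Subordinate Φ q := by
  obtain ⟨k, hk, hkd⟩ := exists_holomorphic_inverse Metric.isOpen_ball hq.1 hq.2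
  have himg : ∀ z, ‖z‖ < 1 → ∃ y, ‖y‖ < 1 ∧ q y = Φ z ∧ k (Φ z) = y := by
    intro z hz
    obtain ⟨ρ, hzρ, hρ1⟩ := exists_between hz
    obtain ⟨y, hy, hyz⟩ := hq.mem_image_ball_of_mem_solutions hη hc hcη hΦ hρ1 hzρ
    have hy1 : ‖y‖ < 1 := (mem_ball_zero_iff.1 hy).trans hρ1
    exact ⟨y, hy1, hyz, by rw [← hyz, hk y (mem_unitDisc.2 hy1)]⟩
  refine ⟨hΦ.1, hq.1, fun z => k (Φ z), fun z hz => ?_, ?_, fun z hz => ?_, fun z hz => ?_⟩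
  · obtain ⟨y, hy, hyz, -⟩ := himg z (mem_unitDisc.1 hz)
    have h1 := (hkd y (mem_unitDisc.2 hy)).differentiableAt
    rw [hyz] at h1
    exact DifferentiableAt.comp_differentiableWithinAt z h1 (hΦ.1 z hz)
  · obtain ⟨-, -, -, ω, -, hω0, -, hω⟩ := hΦ
    have h0 : (0 : ℂ) ∈ unitDisc := mem_unitDisc.2 (by simp)
    have : Φ 0 = q 0 := by simpa [diffOp, hω0] using hω 0 h0
    simp only [this, hk 0 h0]
  · obtain ⟨y, hy, -, hky⟩ := himg z (mem_unitDisc.1 hz)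
    simpa only [hky] using hy
  · obtain ⟨y, hy, hyz, hky⟩ := himg z (mem_unitDisc.1 hz)
    simp only [hky, hyz]

/-- Since `q` is itself a solution of `Φ + η z Φ' ≺ q + η z q'`, it is subordinate to all
dominants. -/
theorem IsUnivalent.isBestDominant {q : ℂ → ℂ} (hq : IsUnivalent q) {η : ℂ}
    (hη : η ≠ 0) (hc : ∀ z, ‖z‖ < 1 → 0 < (1 + z * deriv (deriv q) z / deriv q z).re)
    (hcη : ∀ z, ‖z‖ < 1 → 0 < (1 / η + (1 + z * deriv (deriv q) z / deriv q z)).re) :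
    IsBestDominant η (diffOp η q) q := by
  refine ⟨⟨hq, fun Φ hΦ => hq.subordinate_of_mem_solutions hη hc hcη hΦ⟩, fun r hr => ?_⟩
  have hd : DifferentiableOn ℂ (diffOp η q) unitDisc := fun z hz =>
    (hq.hasDerivAt_diffOp η (mem_unitDisc.1 hz)).differentiableAt.differentiableWithinAt
  exact hr.2 q ⟨hq.1, hd, hd, id, differentiableOn_id, rfl, fun z hz => mem_unitDisc.1 hz,
    fun z _ => rfl⟩

end NonBazilevic

/-! ### Principal powers of holomorphic functions -/

open Filter Topology in
/-- Let `V ^ γ * K` be continuous, with `V`, `K` holomorphic on a connected open set, `V` zero-free,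
and `V = K = 1` at one point. If `γ` is not an integer, then `V` avoids the branch cut of the power.
Indeed `V ^ γ` jumps by the factor `exp (2 π i γ)` wherever `V` meets the cut, so `K` vanishes
there; as `V` is open, such points accumulate, and `K` would be identically zero. -/
theorem forall_mem_slitPlane_or_exists_int {U : Set ℂ} (hU : IsOpen U) (hUc : IsPreconnected U)
    {V K : ℂ → ℂ} {γ : ℂ} (hV : DifferentiableOn ℂ V U) (hK : DifferentiableOn ℂ K U)
    (hV0 : ∀ z ∈ U, V z ≠ 0) (hE : ContinuousOn (fun z => V z ^ γ * K z) U) {z₁ : ℂ} (hz₁ : z₁ ∈ U)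
    (hV1 : V z₁ = 1) (hK1 : K z₁ = 1) :
    (∀ z ∈ U, V z ∈ Complex.slitPlane) ∨ ∃ m : ℤ, γ = m := by
  by_contra hcon
  push Not at hcon
  obtain ⟨⟨z₀, hz₀, hVz₀⟩, hγ⟩ := hcon
  have hopen : ∀ z ∈ U, V z ∉ Complex.slitPlane → 𝓝 (V z) ≤ map V (𝓝 z) := by
    intro z hz hVz
    refine (hV.analyticAt (hU.mem_nhds hz)).eventually_constant_or_nhds_le_map_nhds.resolve_left
      fun hconst => ?_
    have := (hV.analyticOnNhd hU).eqOn_of_preconnected_of_eventuallyEq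
      (analyticOnNhd_const (v := V z)) hUc hz hconst hz₁
    simp only at this
    rw [← this, hV1] at hVz
    exact hVz Complex.one_mem_slitPlane
  have hneg : ∀ z ∈ U, V z ∉ Complex.slitPlane → (V z).re < 0 ∧ (V z).im = 0 := by
    intro z hz hVz
    rw [Complex.mem_slitPlane_iff, not_or, not_lt, not_not] at hVz
    refine ⟨lt_of_le_of_ne hVz.1 fun h => hV0 z hz (Complex.ext h hVz.2), hVz.2⟩
  have hKzero : ∀ z ∈ U, V z ∉ Complex.slitPlane → K z = 0 := by
    intro z hz hVz
    obtain ⟨hre, him⟩ := hneg z hz hVz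
    have hfreq : ∃ᶠ y in 𝓝 (V z), y.im < 0 := by
      have : V z ∈ closure {y : ℂ | y.im < 0} := by
        rw [Complex.closure_setOfPred_im_lt]; exact him.le
      exact mem_closure_iff_frequently.1 this
    have hfreq' : ∃ᶠ w in 𝓝 z, (V w).im < 0 := hfreq.filter_mono (hopen z hz hVz)
    have hne : (𝓝[{w | (V w).im < 0}] z).NeBot :=
      mem_closure_iff_nhdsWithin_neBot.1 (mem_closure_iff_frequently.2 hfreq')
    have hVc : Tendsto V (𝓝[{w | (V w).im < 0}] z) (𝓝[{y : ℂ | y.im < 0}] V z) :=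
      tendsto_nhdsWithin_iff.2 ⟨((hV.continuousOn.continuousAt (hU.mem_nhds hz)).tendsto).mono_left
        nhdsWithin_le_nhds, self_mem_nhdsWithin⟩
    have hlog := (Complex.tendsto_log_nhdsWithin_im_neg_of_re_neg_of_im_zero hre him).comp hVc
    have hKc : Tendsto K (𝓝[{w | (V w).im < 0}] z) (𝓝 (K z)) :=
      ((hK.continuousOn.continuousAt (hU.mem_nhds hz)).tendsto).mono_left nhdsWithin_le_nhds
    have hlim := ((Complex.continuous_exp.tendsto _).comp (hlog.mul_const γ)).mul hKc
    have hlim' : Tendsto (fun z => V z ^ γ * K z) (𝓝[{w | (V w).im < 0}] z)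
        (𝓝 (V z ^ γ * K z)) :=
      ((hE.continuousAt (hU.mem_nhds hz)).tendsto).mono_left nhdsWithin_le_nhds
    have heq := tendsto_nhds_unique hlim' (hlim.congr' (by
      filter_upwards [mem_nhdsWithin_of_mem_nhds (hU.mem_nhds hz)] with w hw
      simp only [Function.comp_apply]
      rw [Complex.cpow_def_of_ne_zero (hV0 w hw)]))
    have hlogz : Complex.log (V z) = Real.log ‖V z‖ + Real.pi * Complex.I := by
      rw [Complex.log, Complex.arg_eq_pi_iff.2 ⟨hre, him⟩]
    rw [Complex.cpow_def_of_ne_zero (hV0 z hz), hlogz] at heq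
    by_contra hKz
    have heq' := mul_right_cancel₀ hKz heq
    obtain ⟨m, hm⟩ := Complex.exp_eq_exp_iff_exists_int.1 heq'
    refine hγ m (mul_left_cancel₀ Complex.two_pi_I_ne_zero ?_)
    linear_combination hm
  have hacc : ∃ᶠ w in 𝓝[≠] z₀, K w = 0 := by
    obtain ⟨hre, him⟩ := hneg z₀ hz₀ hVz₀
    have hline : Tendsto (fun t : ℝ => V z₀ - t) (𝓝[>] 0) (𝓝 (V z₀)) := by
      have : Continuous fun t : ℝ => V z₀ - t := by fun_prop
      exact tendsto_nhdsWithin_of_tendsto_nhds (by simpa using this.tendsto 0)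
    have hfreq : ∃ᶠ y in 𝓝 (V z₀), y ∉ Complex.slitPlane ∧ y ≠ V z₀ := by
      refine hline.frequently (Eventually.frequently ?_)
      filter_upwards [self_mem_nhdsWithin] with t ht
      have ht' : 0 < t := ht
      constructor
      · rw [Complex.mem_slitPlane_iff]
        simp [him]
        linarith
      · intro h
        have : (t : ℂ) = 0 := by linear_combination -h
        exact ht'.ne' (by exact_mod_cast this)
    have hfreq' := frequently_map.1 (hfreq.filter_mono (hopen z₀ hz₀ hVz₀))
    rw [frequently_nhdsWithin_iff]
    refine (hfreq'.and_eventually (hU.mem_nhds hz₀)).mono fun w hw => ⟨hKzero w hw.2 hw.1.1, ?_⟩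
    rintro rfl
    exact hw.1.2 rfl
  have := (hK.analyticOnNhd hU).eqOn_zero_of_preconnected_of_frequently_eq_zero hUc hz₀ hacc hz₁
  rw [hK1] at this
  exact one_ne_zero this

/-- The derivative of a principal power, also across the branch cut if the exponent is an
integer. -/
theorem HasDerivAt.cpow_const_of_mem_slitPlane_or_int {V : ℂ → ℂ} {V' z γ : ℂ}
    (hV : HasDerivAt V V' z) (h0 : V z ≠ 0) (h : V z ∈ Complex.slitPlane ∨ ∃ m : ℤ, γ = m) :
    HasDerivAt (fun w => V w ^ γ) (γ * V z ^ γ * (V' / V z)) z := by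
  rcases h with h | ⟨m, rfl⟩
  · refine (hV.cpow_const h).congr_deriv ?_
    rw [Complex.cpow_sub _ _ h0, Complex.cpow_one]
    field_simp
  · simp only [Complex.cpow_intCast]
    refine ((hasDerivAt_zpow m (V z) (Or.inl h0)).comp z hV).congr_deriv ?_
    rw [zpow_sub_one₀ h0]
    field_simp

/-! ### The quotient `z ^ p / f` -/

namespace NonBazilevic

/-- A function of the class is `z ^ p` times a holomorphic function with value `1` at `0`. -/
theorem exists_eq_pow_mul_of_mem_classA {p n : ℕ} (hn : 1 ≤ n) {f : ℂ → ℂ} (hf : f ∈ classA p n) :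
    ∃ G : ℂ → ℂ, DifferentiableOn ℂ G unitDisc ∧ G 0 = 1 ∧
      ∀ z ∈ unitDisc, f z = z ^ p * G z := by
  obtain ⟨⟨hfd, -, -⟩, a, ha⟩ := hf
  set G : ℂ → ℂ := fun z => if z = 0 then 1 else f z / z ^ p with hG
  have hG0 : G 0 = 1 := by simp [hG]
  have hfG : ∀ z ∈ unitDisc, f z = z ^ p * G z := by
    intro z hz
    rcases eq_or_ne z 0 with rfl | hz0
    · have h0 := (ha 0 hz).unique (by
        have : (fun k : ℕ => a (n + k + p) * (0 : ℂ) ^ (n + k + p)) = fun _ => 0 := by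
          funext k; rw [zero_pow (by omega), mul_zero]
        rw [this]; exact hasSum_zero)
      rw [hG0, mul_one]
      exact sub_eq_zero.1 h0
    · simp only [hG, hz0, if_false]
      field_simp
  have hsum : ∀ z ∈ unitDisc, HasSum (fun k : ℕ => a (n + k + p) * z ^ (n + k)) (G z - 1) := by
    intro z hz
    rcases eq_or_ne z 0 with rfl | hz0
    · have : (fun k : ℕ => a (n + k + p) * (0 : ℂ) ^ (n + k)) = fun _ => 0 := by
        funext k; rw [zero_pow (by omega), mul_zero]
      rw [this, hG0, sub_self]; exact hasSum_zero
    · have hzp : z ^ p ≠ 0 := pow_ne_zero p hz0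
      have h := (ha z hz).div_const (z ^ p)
      rw [hfG z hz] at h
      have e1 : (fun k : ℕ => a (n + k + p) * z ^ (n + k)) =
          fun k => a (n + k + p) * z ^ (n + k + p) / z ^ p := by
        funext k; rw [pow_add z (n + k) p]; field_simp
      have e2 : G z - 1 = (z ^ p * G z - z ^ p) / z ^ p := by field_simp
      rw [e1, e2]
      exact h
  refine ⟨G, fun z hz => DifferentiableAt.differentiableWithinAt ?_, hG0, hfG⟩
  rcases eq_or_ne z 0 with rfl | hz0
  · set b : ℕ → ℂ := fun m => if m < n then 0 else a (m + p) with hb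
    have hser : HasFPowerSeriesAt (fun z => G z - 1) (FormalMultilinearSeries.ofScalars ℂ b) 0 := by
      rw [hasFPowerSeriesAt_iff']
      filter_upwards [Metric.isOpen_ball.mem_nhds hz] with w hw
      rw [← hasSum_nat_add_iff' n]
      have hz' : ∑ i ∈ Finset.range n,
          (w - 0) ^ i • (FormalMultilinearSeries.ofScalars ℂ b).coeff i = 0 := by
        refine Finset.sum_eq_zero fun i hi => ?_
        simp [hb, Finset.mem_range.1 hi]
      rw [hz', sub_zero, sub_zero]
      have e : (fun k => w ^ (k + n) •
          (FormalMultilinearSeries.ofScalars ℂ b).coeff (k + n)) =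
          fun k => a (n + k + p) * w ^ (n + k) := by
        funext k
        simp [hb, add_comm n k, mul_comm]
      rw [e]
      exact hsum w hw
    have := hser.analyticAt.differentiableAt.add_const 1
    simpa using this
  · have h : DifferentiableAt ℂ (fun w => f w / w ^ p) z :=
      (hfd.differentiableAt (Metric.isOpen_ball.mem_nhds hz)).fun_div (by fun_prop)
        (pow_ne_zero p hz0)
    refine h.congr_of_eventuallyEq ?_
    filter_upwards [isOpen_ne.mem_nhds hz0] with w hw
    have hw' : w ≠ 0 := hw
    simp [hG, hw']

/-- As a `p`-valent function with a zero of order `p` at `0` has no other zeros, `z ^ p / f` extends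
to a zero-free holomorphic function `V`; and `z f' / (p f) = 1 - z V' / (p V)`. -/
theorem exists_quotient_of_mem_classA {p n : ℕ} (hp : 1 ≤ p) (hn : 1 ≤ n) {f : ℂ → ℂ}
    (hf : f ∈ classA p n) :
    ∃ V : ℂ → ℂ, DifferentiableOn ℂ V unitDisc ∧ V 0 = 1 ∧ ∀ z ∈ unitDisc, V z ≠ 0 ∧
      (∀ γ, powQuotient p γ f z = V z ^ γ) ∧ logQuotient p f z = 1 - z * deriv V z / (p * V z) := by
  obtain ⟨G, hGd, hG0, hfG⟩ := exists_eq_pow_mul_of_mem_classA hn hf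
  obtain ⟨⟨hfd, hval, -⟩, -⟩ := hf
  have h0U : (0 : ℂ) ∈ unitDisc := mem_unitDisc.2 (by simp)
  have hnhds : ∀ z ∈ unitDisc, unitDisc ∈ nhds z := fun z hz => Metric.isOpen_ball.mem_nhds hz
  have hGne : ∀ z ∈ unitDisc, G z ≠ 0 := by
    intro z hz hGz
    have hz0 : z ≠ 0 := by rintro rfl; simp [hG0] at hGz
    have hv := hval 0 {0, z} (by
      intro w hw
      rcases (by simpa using hw : w = 0 ∨ w = z) with rfl | rfl <;> assumption)
    simp only [sub_zero] at hv
    rw [Finset.sum_pair hz0.symm] at hv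
    have h1 : (p : ℕ∞) ≤ analyticOrderAt f 0 := by
      rw [natCast_le_analyticOrderAt (hfd.analyticAt (hnhds 0 h0U))]
      refine ⟨G, hGd.analyticAt (hnhds 0 h0U), ?_⟩
      filter_upwards [hnhds 0 h0U] with w hw
      rw [hfG w hw, sub_zero, smul_eq_mul]
    have h2 : (1 : ℕ∞) ≤ analyticOrderAt f z := by
      rw [Order.one_le_iff_ne_zero, (hfd.analyticAt (hnhds z hz)).analyticOrderAt_ne_zero,
        hfG z hz, hGz, mul_zero]
    have h3 : ((p + 1 : ℕ) : ℕ∞) ≤ p := by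
      push_cast; exact (add_le_add h1 h2).trans hv
    have h4 : p + 1 ≤ p := by exact_mod_cast h3
    omega
  have hpC : (p : ℂ) ≠ 0 := by exact_mod_cast (by omega : p ≠ 0)
  refine ⟨fun z => (G z)⁻¹, hGd.fun_inv hGne, by simp [hG0], fun z hz =>
    ⟨inv_ne_zero (hGne z hz), fun γ => ?_, ?_⟩⟩
  · rcases eq_or_ne z 0 with rfl | hz0
    · simp [powQuotient, hG0]
    · have := pow_ne_zero p hz0
      rw [powQuotient, if_neg hz0, hfG z hz, div_mul_cancel_left₀ this]
  · have hGz := hGne z hz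
    have hGz' := (hGd.differentiableAt (hnhds z hz)).hasDerivAt
    rcases eq_or_ne z 0 with rfl | hz0
    · simp [logQuotient]
    · have hf' : HasDerivAt f ((p : ℂ) * z ^ (p - 1) * G z + z ^ p * deriv G z) z := by
        refine ((hasDerivAt_pow p z).fun_mul hGz').congr_of_eventuallyEq ?_
        filter_upwards [hnhds z hz] with w hw using hfG w hw
      have hpow : z ^ p = z ^ (p - 1) * z := by rw [← pow_succ, Nat.sub_add_cancel hp]
      have := pow_ne_zero (p - 1) hz0
      rw [logQuotient, if_neg hz0, hf'.deriv, (hGz'.fun_inv hGz).deriv, hfG z hz, hpow]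
      field_simp
      ring

/-- The expression `(1 + μ) (z ^ p / f) ^ γ - μ (z f' / (p f)) (z ^ p / f) ^ γ` is obtained from
`Φ = (z ^ p / f) ^ γ` by the operator `Φ + μ / (p γ) z Φ'`. The power is the principal one, but it
is holomorphic once the expression is. -/
theorem powQuotient_mem_solutions {p n : ℕ} (hp : 1 ≤ p) (hn : 1 ≤ n) {f : ℂ → ℂ}
    (hf : f ∈ classA p n) {μ γ : ℂ} (hγ : γ ≠ 0) {h : ℂ → ℂ}
    (hsub : Subordinate (definingExpr p μ γ f) h) :
    powQuotient p γ f ∈ solutions (μ / (p * γ)) h := by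
  obtain ⟨V, hVd, hV0, hV⟩ := exists_quotient_of_mem_classA hp hn hf
  obtain ⟨hEd, hhd, ω, hωd, hω0, hω1, hω⟩ := hsub
  have h0U : (0 : ℂ) ∈ unitDisc := mem_unitDisc.2 (by simp)
  have hnhds : ∀ z ∈ unitDisc, unitDisc ∈ nhds z := fun z hz => Metric.isOpen_ball.mem_nhds hz
  have hpC : (p : ℂ) ≠ 0 := by exact_mod_cast (by omega : p ≠ 0)
  have hE : ∀ z ∈ unitDisc, definingExpr p μ γ f z =
      V z ^ γ * (1 + μ * (z * deriv V z / (p * V z))) := by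
    intro z hz
    obtain ⟨-, h1, h2⟩ := hV z hz
    rw [definingExpr, h1, h2]; ring
  have hKd : DifferentiableOn ℂ (fun z => 1 + μ * (z * deriv V z / (p * V z))) unitDisc :=
    (((differentiableOn_id.fun_mul (hVd.deriv Metric.isOpen_ball)).fun_div (hVd.const_mul _)
      fun z hz => mul_ne_zero hpC (hV z hz).1).const_mul μ).const_add 1
  have hcases := forall_mem_slitPlane_or_exists_int Metric.isOpen_ball
    (convex_ball (0 : ℂ) 1).isPreconnected hVd hKd (fun z hz => (hV z hz).1)
    (hEd.continuousOn.congr fun z hz => (hE z hz).symm) h0U hV0 (by simp)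
  have hder : ∀ z ∈ unitDisc,
      HasDerivAt (powQuotient p γ f) (γ * V z ^ γ * (deriv V z / V z)) z := by
    intro z hz
    have h1 := (hVd.differentiableAt (hnhds z hz)).hasDerivAt.cpow_const_of_mem_slitPlane_or_int
      (hV z hz).1 (hcases.imp_left fun h => h z hz)
    refine h1.congr_of_eventuallyEq ?_
    filter_upwards [hnhds z hz] with w hw using (hV w hw).2.1 γ
  have hdiff : ∀ z ∈ unitDisc, diffOp (μ / (p * γ)) (powQuotient p γ f) z =
      definingExpr p μ γ f z := by
    intro z hz
    have hVz := (hV z hz).1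
    rw [diffOp, (hder z hz).deriv, (hV z hz).2.1, hE z hz]
    field_simp
  exact ⟨fun z hz => (hder z hz).differentiableAt.differentiableWithinAt, hEd.congr hdiff, hhd, ω,
    hωd, hω0, hω1, fun z hz => (hdiff z hz).trans (hω z hz)⟩

end NonBazilevic

theorem mainTheorem5 (p : ℕ) (hp : 1 ≤ p) (μ : ℂ) (hμ : μ ≠ 0) (α β : ℝ) (hα : 0 ≤ α)
    (hαβ : (α : ℂ) + Complex.I * β ≠ 0)
    (q : ℂ → ℂ) (hq : NonBazilevic.IsUnivalent q)
    (hconv : ∀ z ∈ NonBazilevic.unitDisc,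
      max 0 (-((p : ℂ) * (α + Complex.I * β) / μ).re)
        < (1 + z * deriv (deriv q) z / deriv q z).re) :
    (∀ (n : ℕ), 1 ≤ n → ∀ f ∈ NonBazilevic.classA p n,
      NonBazilevic.Subordinate
        (NonBazilevic.definingExpr p μ (α + Complex.I * β) f)
        (fun z => q z + μ * (z * deriv q z) / ((p : ℂ) * (α + Complex.I * β))) →
      NonBazilevic.Subordinate
        (NonBazilevic.powQuotient p (α + Complex.I * β) f) q) ∧
    NonBazilevic.IsBestDominant (μ / ((p : ℂ) * (α + Complex.I * β)))
      (fun z => q z + μ * (z * deriv q z) / ((p : ℂ) * (α + Complex.I * β))) q := by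
  have hpC : (p : ℂ) ≠ 0 := by exact_mod_cast (by omega : p ≠ 0)
  have hη : μ / ((p : ℂ) * (α + Complex.I * β)) ≠ 0 := div_ne_zero hμ (mul_ne_zero hpC hαβ)
  have hh : (fun z => q z + μ * (z * deriv q z) / ((p : ℂ) * (α + Complex.I * β))) =
      NonBazilevic.diffOp (μ / ((p : ℂ) * (α + Complex.I * β))) q := by
    funext z
    rw [NonBazilevic.diffOp]
    ring
  have hc : ∀ z, ‖z‖ < 1 → 0 < (1 + z * deriv (deriv q) z / deriv q z).re := fun z hz =>
    (le_max_left _ _).trans_lt (hconv z (NonBazilevic.mem_unitDisc.2 hz))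
  have hcη : ∀ z, ‖z‖ < 1 → 0 < (1 / (μ / ((p : ℂ) * (α + Complex.I * β))) +
      (1 + z * deriv (deriv q) z / deriv q z)).re := fun z hz => by
    have := (le_max_right _ _).trans_lt (hconv z (NonBazilevic.mem_unitDisc.2 hz))
    rw [one_div_div, Complex.add_re]
    linarith
  rw [hh]
  have hbest := hq.isBestDominant hη hc hcη
  exact ⟨fun n hn f hf hsub =>
    hbest.1.2 _ (NonBazilevic.powQuotient_mem_solutions hp hn hf hαβ hsub), hbest⟩
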